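/- A \emph{restriction monoid} is a monoid $S$ with unary operations ${}^+,{}^*$ satisfying $x^+x=x$, $x^+y^+=y^+x^+$, $(x^+y)^+=x^+y^+$, $xy^+=(xy)^+x$, the left-right duals of these identities for ${}^*$, and $(x^+)^*=x^+$, $(x^*)^+=x^*$; omitting the identity element one speaks of a \emph{restriction semigroup}. Morphisms, subsemigroups, congruences and embeddings of type $(2,1,1)$ respect $\cdot,{}^+,{}^*$. Let $P(S)=\{x^+:x\in S\}$, a semilattice under multiplication with identity $1$; let $a\le b$ iff $a=a^+b$, and $a\,\sigma\,b$ iff $ea=eb$ for some $e\in P(S)$. $S$ is \emph{perfect} if $(a\sigma)(b\sigma)=(ab)\sigma$ (product of sets) for all $a,b\in S$ and every $\sigma$-class has a greatest element with respect to $\le$. The \emph{induced left partial action} $\diamond$ of $S/\sigma$ on $P(S)$ is given by: $t\diamond A$ is defined and equals $B$ iff there is $s\in S$ with $s\sigma=t$, $s^*=A$, $s^+=B$. If a monoid $T$ acts on a semilattice $\mathcal X$ by automorphisms, $\mathcal X\rtimes T$ is the restriction semigroup on $\mathcal X\times T$ with $(a,t)(b,u)=(a\wedge t\cdot b,tu)$,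 $(a,t)^+=(a,1)$, $(t\cdot a,t)^*=(a,1)$. Let $T$ be a submonoid of a group $G$ acting on $\mathcal X$ by automorphisms, and let $e\in\mathcal X$. A factorisation $g=w_1\cdots w_n$ ($n\ge 1$) in $G$ is \emph{nice} with respect to $e$ if $w_i=t_i^{\epsilon_i}$ with $t_i\in T$, $\epsilon_i\in\{1,-1\}$, where $\epsilon_i=\epsilon_j$ iff $2\mid i-j$, and $w_i\cdot e\ge e\wedge w_i\cdots w_n\cdot e$ for $1\le i<n$. The action of $T$ is \emph{nice over $G$ with respect to $e$} if every $g\in G$ has a nice factorisation; if moreover $\mathcal X=G\cdot\{y\in\mathcal X:y\le e\}$, then $\mathcal X\rtimes T$ is a \emph{nice semidirect product}. \textbf{Theorem.} Let $S$ be a perfect restriction monoid such that $S/\sigma$ is (isomorphic to) the free monoid $\Omega^*$ on a set $\Omega$; identify $S/\sigma$ with $\Omega^*$, and let $FG(\Omega)\supseteq\Omega^*$ be the free group. Then there are a semilattice $\mathcal X$ containing $P(S)$ as a principal ideal and an action $\cdot$ of $FG(\Omega)$ on $\mathcal X$ by automorphisms such that - the action of $\Omega^*$ extends the induced left partial action: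 for $t\in S/\sigma$ and $A,B\in P(S)$, $t\cdot A=B$ iff $t\diamond A$ is defined and equals $B$; - the action of $\Omega^*$ is nice over $FG(\Omega)$ with respect to the identity of $P(S)$, and $\mathcal X=FG(\Omega)\cdot P(S)$, so $\mathcal X\rtimes\Omega^*$ is a nice semidirect product; - $\mathcal X\rtimes FG(\Omega)$ is an inverse semigroup, with $a^+=aa^{-1}$ and $a^*=a^{-1}a$, and $\mathcal X\rtimes\Omega^*$ is a $(2,1,1)$-subsemigroup of it; - the map $s\mapsto(s^+,s\sigma)$ is a $(2,1,1)$-embedding of $S$ in $\mathcal X\rtimes\Omega^*$. Moreover: (i) every $(2,1,1)$-congruence $\rho$ of $S$ extends along this embedding, i.e. some $(2,1,1)$-congruence of $\mathcal X\rtimes\Omega^*$ restricts to $\rho$ on the image of $S$; (ii) for every $(2,1,1)$-congruence $\rho\subseteq\sigma$ of $S$ there is an $FG(\Omega)$-invariant congruence $\varepsilon$ on $\mathcal X$ such that, for the induced action, $(\mathcal X/\varepsilon)\rtimes\Omega^*$ is a nice semidirect product (over $FG(\Omega)$, with respect to the class of the identity of $P(S)$) and $S/\rho$ is $(2,1,1)$-embeddable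 in it. -/

import Mathlib

universe u v

/-- A restriction semigroup: an algebra `(S; ·, ⁺, ^*)` of type `(2,1,1)`, where `rplus x` is `x⁺`
and `rstar x` is `x^*`. -/
class RestrictionSemigroup (S : Type*) extends Semigroup S where
  rplus : S → S
  rstar : S → S
  rplus_mul_self : ∀ x : S, rplus x * x = x
  rplus_comm : ∀ x y : S, rplus x * rplus y = rplus y * rplus x
  rplus_rplus_mul : ∀ x y : S, rplus (rplus x * y) = rplus x * rplus y
  mul_rplus : ∀ x y : S, x * rplus y = rplus (x * y) * x
  mul_rstar_self : ∀ x : S, x * rstar x = x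
  rstar_comm : ∀ x y : S, rstar x * rstar y = rstar y * rstar x
  rstar_mul_rstar : ∀ x y : S, rstar (x * rstar y) = rstar x * rstar y
  rstar_mul : ∀ x y : S, rstar y * x = x * rstar (y * x)
  rstar_rplus : ∀ x : S, rstar (rplus x) = rplus x
  rplus_rstar : ∀ x : S, rplus (rstar x) = rstar x

/-- A restriction monoid: a restriction semigroup with an identity element. -/
class RestrictionMonoid (S : Type*) extends Monoid S, RestrictionSemigroup S

open RestrictionSemigroup

section Basics

variable {S : Type*} [RestrictionSemigroup S]

theorem rplus_idem (x : S) : rplus x * rplus x = rplus x := by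
  rw [← rplus_rplus_mul, rplus_mul_self]

/-- `e ∈ P(S)`: the projections of `S` are the elements `x⁺` (equivalently, the elements `x^*`). -/
def IsProj (e : S) : Prop := ∃ x : S, rplus x = e

theorem IsProj.mul {e f : S} (he : IsProj e) (hf : IsProj f) : IsProj (e * f) := by
  obtain ⟨x, rfl⟩ := he
  obtain ⟨y, rfl⟩ := hf
  exact ⟨rplus x * y, rplus_rplus_mul x y⟩

/-- The natural partial order: `a ≤ b` iff `a = a⁺ b`. -/
def NatLE (a b : S) : Prop := a = rplus a * b

/-- A `(2,1,1)`-morphism which is injective. -/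
structure IsRestrictionEmbedding {S' : Type*} [RestrictionSemigroup S'] (f : S → S') : Prop where
  injective : Function.Injective f
  map_mul : ∀ a b, f (a * b) = f a * f b
  map_rplus : ∀ a, f (rplus a) = rplus (f a)
  map_rstar : ∀ a, f (rstar a) = rstar (f a)

variable (S) in
/-- `S` is an inverse semigroup (every `a` has a unique inverse `b`), and its unary operations are
the ones it has as an inverse semigroup, `a⁺ = a a⁻¹` and `a^* = a⁻¹ a`. -/
def IsInverseSemigroup : Prop :=
  (∀ a : S, ∃! b : S, a * b * a = a ∧ b * a * b = b) ∧
  ∀ a b : S, a * b * a = a → b * a * b = b → rplus a = a * b ∧ rstar a = b * a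

variable (S) in
/-- A `(2,1,1)`-congruence. -/
structure RestrictionCon extends Con S where
  rplus' : ∀ {a b : S}, r a b → r (rplus a) (rplus b)
  rstar' : ∀ {a b : S}, r a b → r (rstar a) (rstar b)

/-- The factor `S/ρ` by a `(2,1,1)`-congruence. -/
def RestrictionCon.Quotient (ρ : RestrictionCon S) : Type _ := ρ.toCon.Quotient

instance (ρ : RestrictionCon S) : RestrictionSemigroup ρ.Quotient :=
  { (inferInstance : Semigroup ρ.toCon.Quotient) with
    rplus := Quotient.map rplus fun _ _ h => ρ.rplus' h
    rstar := Quotient.map rstar fun _ _ h => ρ.rstar' h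
    rplus_mul_self := by
      rintro ⟨x⟩; exact congrArg _ (rplus_mul_self x)
    rplus_comm := by
      rintro ⟨x⟩ ⟨y⟩; exact congrArg _ (rplus_comm x y)
    rplus_rplus_mul := by
      rintro ⟨x⟩ ⟨y⟩; exact congrArg _ (rplus_rplus_mul x y)
    mul_rplus := by
      rintro ⟨x⟩ ⟨y⟩; exact congrArg _ (mul_rplus x y)
    mul_rstar_self := by
      rintro ⟨x⟩; exact congrArg _ (mul_rstar_self x)
    rstar_comm := by
      rintro ⟨x⟩ ⟨y⟩; exact congrArg _ (rstar_comm x y)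
    rstar_mul_rstar := by
      rintro ⟨x⟩ ⟨y⟩; exact congrArg _ (rstar_mul_rstar x y)
    rstar_mul := by
      rintro ⟨x⟩ ⟨y⟩; exact congrArg _ (rstar_mul x y)
    rstar_rplus := by
      rintro ⟨x⟩; exact congrArg _ (rstar_rplus x)
    rplus_rstar := by
      rintro ⟨x⟩; exact congrArg _ (rplus_rstar x) }

/-- The congruence `ρ` of `S` extends to `S'` along the map `f : S → S'`. -/
def RestrictionCon.ExtendsAlong {S' : Type*} [RestrictionSemigroup S'] (ρ : RestrictionCon S)
    (f : S → S') : Prop :=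
  ∃ ρ' : RestrictionCon S', ∀ a b : S, ρ'.r (f a) (f b) ↔ ρ.r a b

variable (S) in
/-- The relation `σ` on `S`: `a σ b` iff `e a = e b` for some projection `e`. -/
def sigma : Con S where
  r a b := ∃ e : S, IsProj e ∧ e * a = e * b
  iseqv :=
    { refl := fun a => ⟨rplus a, ⟨a, rfl⟩, rfl⟩
      symm := fun ⟨e, he, h⟩ => ⟨e, he, h.symm⟩
      trans := by
        rintro a b c ⟨e, he, h⟩ ⟨f, hf, h'⟩
        refine ⟨e * f, he.mul hf, ?_⟩
        have hc : e * f = f * e := by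
          obtain ⟨x, rfl⟩ := he
          obtain ⟨y, rfl⟩ := hf
          exact rplus_comm x y
        calc e * f * a = f * (e * a) := by rw [hc, mul_assoc]
          _ = e * (f * b) := by rw [h, ← mul_assoc, ← hc, mul_assoc]
          _ = e * f * c := by rw [h', mul_assoc] }
  mul' := by
    rintro a b c d ⟨e, ⟨x, rfl⟩, h⟩ ⟨f, ⟨y, rfl⟩, h'⟩
    refine ⟨rplus x * rplus (a * y), IsProj.mul ⟨x, rfl⟩ ⟨_, rfl⟩, ?_⟩
    have h1 : rplus (a * y) * a * c = rplus (a * y) * a * d := by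
      rw [← mul_rplus, mul_assoc, h', mul_assoc]
    calc rplus x * rplus (a * y) * (a * c)
        = rplus x * (rplus (a * y) * a * c) := by simp only [mul_assoc]
      _ = rplus x * rplus (a * y) * (a * d) := by rw [h1]; simp only [mul_assoc]
      _ = rplus (a * y) * (rplus x * a) * d := by rw [rplus_comm]; simp only [mul_assoc]
      _ = rplus x * rplus (a * y) * (b * d) := by rw [h, rplus_comm x]; simp only [mul_assoc]

/-- A congruence `ρ` on a semigroup is perfect if `(aρ)(bρ) = (ab)ρ`, the left hand side being the
product of subsets. -/
def IsPerfectCon {M : Type*} [Semigroup M] (ρ : Con M) : Prop :=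
  ∀ a b : M, Set.image2 (fun x y => x * y) {x | ρ a x} {y | ρ b y} = {z | ρ (a * b) z}

variable (S) in
/-- The semilattice `P(S)` of projections. -/
def Proj : Type _ := {e : S // IsProj e}

/-- The semilattice structure of `P(S)`: the meet is the product of `S`. -/
instance : SemilatticeInf (Proj S) :=
  @SemilatticeInf.mk' _ ⟨fun e f => ⟨e.1 * f.1, e.2.mul f.2⟩⟩
    (by rintro ⟨_, x, rfl⟩ ⟨_, y, rfl⟩; exact Subtype.ext (rplus_comm x y))
    (fun e f g => Subtype.ext (mul_assoc e.1 f.1 g.1))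
    (by rintro ⟨_, x, rfl⟩; exact Subtype.ext (rplus_idem x))

/-- The projection `s⁺`. -/
def projPlus (s : S) : Proj S := ⟨rplus s, s, rfl⟩

/-- The projection `s^*`. -/
def projStar (s : S) : Proj S := ⟨rstar s, rstar s, rplus_rstar s⟩

/-- The left partial action `⋄` of `S/σ` on `P(S)` induced by `S`, given by its graph: `t ⋄ A` is
defined and equal to `B` iff `A = s^*` and `B = s⁺` for some `s` in the `σ`-class `t`. -/
def InducedPartialAction (t : (sigma S).Quotient) (A B : Proj S) : Prop :=
  ∃ s : S, (s : (sigma S).Quotient) = t ∧ projStar s = A ∧ projPlus s = B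

end Basics

/-- The identity element of `P(S)` for a restriction monoid `S`, that is, the identity of `S`. -/
def projOne (S : Type*) [RestrictionMonoid S] : Proj S :=
  ⟨1, 1, by simpa using rplus_mul_self (1 : S)⟩

/-- A restriction monoid is perfect if `σ` is a perfect congruence and each `σ`-class has a greatest
element with respect to the natural partial order. -/
def IsPerfectRestrictionMonoid (S : Type*) [RestrictionMonoid S] : Prop :=
  IsPerfectCon (sigma S) ∧ ∀ a : S, ∃ m : S, sigma S a m ∧ ∀ b : S, sigma S a b → NatLE b m

section Semidirect

variable {X T G : Type*} [SemilatticeInf X] [Monoid T] [Group G]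

/-- The semidirect product `X ⋊ T`, for an action `α : T → Aut X` of the monoid `T` on the
semilattice `X` by automorphisms. (Semilattice automorphisms are the order automorphisms.) -/
@[ext]
structure SemidirectProd (α : T →* (X ≃o X)) where
  fst : X
  snd : T

/-- `(a,t)(b,u) = (a ∧ t·b, tu)`, `(a,t)⁺ = (a,1)`, `(t·a,t)^* = (a,1)`. -/
instance (α : T →* (X ≃o X)) : RestrictionSemigroup (SemidirectProd α) where
  mul p q := ⟨p.fst ⊓ α p.snd q.fst, p.snd * q.snd⟩
  rplus p := ⟨p.fst, 1⟩
  rstar p := ⟨(α p.snd).symm p.fst, 1⟩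
  mul_assoc p q r := by
    apply SemidirectProd.ext
    · change p.fst ⊓ α p.snd q.fst ⊓ α (p.snd * q.snd) r.fst
        = p.fst ⊓ α p.snd (q.fst ⊓ α q.snd r.fst)
      simp [inf_assoc]
    · exact mul_assoc _ _ _
  rplus_mul_self p := by
    apply SemidirectProd.ext
    · change p.fst ⊓ α 1 p.fst = p.fst
      simp
    · exact one_mul _
  rplus_comm p q := by
    apply SemidirectProd.ext
    · change p.fst ⊓ α 1 q.fst = q.fst ⊓ α 1 p.fst
      simp [inf_comm]
    · rfl
  rplus_rplus_mul p q := by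
    apply SemidirectProd.ext
    · rfl
    · exact (one_mul _).symm
  mul_rplus p q := by
    apply SemidirectProd.ext
    · change p.fst ⊓ α p.snd q.fst = p.fst ⊓ α p.snd q.fst ⊓ α 1 p.fst
      simp
    · change p.snd * 1 = 1 * p.snd
      simp
  mul_rstar_self p := by
    apply SemidirectProd.ext
    · change p.fst ⊓ α p.snd ((α p.snd).symm p.fst) = p.fst
      simp
    · exact mul_one _
  rstar_comm p q := by
    apply SemidirectProd.ext
    · change (α p.snd).symm p.fst ⊓ α 1 ((α q.snd).symm q.fst)
        = (α q.snd).symm q.fst ⊓ α 1 ((α p.snd).symm p.fst)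
      simp [inf_comm]
    · rfl
  rstar_mul_rstar p q := by
    apply SemidirectProd.ext
    · change (α (p.snd * 1)).symm (p.fst ⊓ α p.snd ((α q.snd).symm q.fst))
        = (α p.snd).symm p.fst ⊓ α 1 ((α q.snd).symm q.fst)
      simp
    · exact (one_mul _).symm
  rstar_mul p q := by
    apply SemidirectProd.ext
    · change (α q.snd).symm q.fst ⊓ α 1 p.fst
        = p.fst ⊓ α p.snd ((α (q.snd * p.snd)).symm (q.fst ⊓ α q.snd p.fst))
      have h : ∀ x, α p.snd ((α (q.snd * p.snd)).symm x) = (α q.snd).symm x := by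
        intro x
        apply (α q.snd).injective
        rw [OrderIso.apply_symm_apply, ← RelIso.mul_apply, ← map_mul]
        exact OrderIso.apply_symm_apply _ _
      rw [h]
      simp [inf_comm]
    · change 1 * p.snd = p.snd * 1
      simp
  rstar_rplus p := by
    apply SemidirectProd.ext
    · change (α 1).symm p.fst = p.fst
      rw [OrderIso.symm_apply_eq]
      simp
    · rfl
  rplus_rstar _ := rfl

/-- A finite sequence `w` in `G` is alternating in `T` (mapped to `G` by `j`) if `w_i = t_i ^ ε_i`
with `t_i ∈ T`, `ε_i ∈ {1,-1}`, and `ε_i = ε_k` iff `2 ∣ i - k`. -/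
def IsAlternating (j : T →* G) (w : List G) : Prop :=
  ∃ (t : Fin w.length → T) (ε : Fin w.length → ℤˣ),
    (∀ i, w.get i = j (t i) ^ (ε i : ℤ)) ∧
    ∀ i k, ε i = ε k ↔ (2 : ℤ) ∣ ((i : ℕ) : ℤ) - ((k : ℕ) : ℤ)

/-- `g = w_1 ⋯ w_n` is a nice factorisation in `T` with respect to `e`: it is alternating, and
`w_i · e ≥ e ∧ (w_i ⋯ w_n) · e` for `1 ≤ i < n`. -/
def IsNiceFactorisation (j : T →* G) (β : G →* (X ≃o X)) (e : X) (g : G) (w : List G) : Prop :=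
  w ≠ [] ∧ w.prod = g ∧ IsAlternating j w ∧
    ∀ i : Fin w.length, (i : ℕ) + 1 < w.length →
      e ⊓ β (w.drop i).prod e ≤ β (w.get i) e

/-- The restriction to `T` of the action `β` of `G` is nice over `G` with respect to `e`. -/
def IsNiceAction (j : T →* G) (β : G →* (X ≃o X)) (e : X) : Prop :=
  ∀ g : G, ∃ w : List G, IsNiceFactorisation j β e g w

/-- `X ⋊ T` is a nice semidirect product, witnessed by the embedding `j : T → G`, the action `β` of
`G` on `X` (whose restriction is the action of `T`), and `e ∈ X`: the action is nice over `G` with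
respect to `e`, and `X = G · Y` for the principal ideal `Y` generated by `e`. -/
def IsNiceSemidirectProd (j : T →* G) (β : G →* (X ≃o X)) (e : X) : Prop :=
  Function.Injective j ∧ IsNiceAction j β e ∧ ∀ x : X, ∃ (g : G) (y : X), y ≤ e ∧ x = β g y

variable (X) in
/-- A semilattice congruence on `X`. -/
structure SemilatticeCon extends Setoid X where
  inf' : ∀ {a b c d : X}, r a b → r c d → r (a ⊓ c) (b ⊓ d)

/-- The factor semilattice `X/ε`. -/
def SemilatticeCon.Quotient (ε : SemilatticeCon X) : Type _ := _root_.Quotient ε.toSetoid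

/-- The class of `x` in `X/ε`. -/
def SemilatticeCon.cls (ε : SemilatticeCon X) (x : X) : ε.Quotient := Quotient.mk ε.toSetoid x

instance (ε : SemilatticeCon X) : SemilatticeInf ε.Quotient :=
  @SemilatticeInf.mk' _ ⟨Quotient.map₂ (fun a b => a ⊓ b) fun _ _ h _ _ h' => ε.inf' h h'⟩
    (by rintro ⟨a⟩ ⟨b⟩; exact congrArg ε.cls (inf_comm a b))
    (by rintro ⟨a⟩ ⟨b⟩ ⟨c⟩; exact congrArg ε.cls (inf_assoc a b c))
    (by rintro ⟨a⟩; exact congrArg ε.cls (inf_idem a))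

/-- `ε` is `G`-invariant: `x ε x'` implies `g·x ε g·x'`. -/
def SemilatticeCon.Invariant (ε : SemilatticeCon X) (β : G →* (X ≃o X)) : Prop :=
  ∀ (g : G) (x y : X), ε.r x y → ε.r (β g x) (β g y)

/-- The map `xε ↦ (g·x)ε`. -/
def SemilatticeCon.actMap (ε : SemilatticeCon X) (β : G →* (X ≃o X)) (h : ε.Invariant β) (g : G) :
    ε.Quotient → ε.Quotient :=
  Quotient.map (β g) fun x y hxy => h g x y hxy

theorem SemilatticeCon.actMap_mono (ε : SemilatticeCon X) (β : G →* (X ≃o X)) (h : ε.Invariant β)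
    (g : G) : Monotone (ε.actMap β h g) := by
  intro a b hab
  have key : ∀ c d : ε.Quotient,
      ε.actMap β h g (c ⊓ d) = ε.actMap β h g c ⊓ ε.actMap β h g d := by
    rintro ⟨c⟩ ⟨d⟩
    exact congrArg ε.cls (map_inf (β g) c d)
  rw [← inf_eq_left] at hab ⊢
  rw [← key, hab]

theorem SemilatticeCon.actMap_mul (ε : SemilatticeCon X) (β : G →* (X ≃o X)) (h : ε.Invariant β)
    (g k : G) (x : ε.Quotient) :
    ε.actMap β h (g * k) x = ε.actMap β h g (ε.actMap β h k x) := by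
  induction x using Quotient.inductionOn with | _ x =>
  refine congrArg ε.cls ?_
  rw [map_mul, RelIso.mul_apply]

theorem SemilatticeCon.actMap_one (ε : SemilatticeCon X) (β : G →* (X ≃o X)) (h : ε.Invariant β)
    (x : ε.Quotient) : ε.actMap β h 1 x = x := by
  induction x using Quotient.inductionOn with | _ x =>
  refine congrArg ε.cls ?_
  rw [map_one, RelIso.one_apply]

/-- The action of `G` on `X/ε` induced by an action on `X`: `g·(xε) = (g·x)ε`. -/
def SemilatticeCon.quotientAction (ε : SemilatticeCon X) (β : G →* (X ≃o X)) (h : ε.Invariant β) :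
    G →* (ε.Quotient ≃o ε.Quotient) where
  toFun g := (Equiv.mk (ε.actMap β h g) (ε.actMap β h g⁻¹)
      (fun x => by rw [← ε.actMap_mul, inv_mul_cancel, ε.actMap_one])
      (fun x => by rw [← ε.actMap_mul, mul_inv_cancel, ε.actMap_one])).toOrderIso
    (ε.actMap_mono β h g) (ε.actMap_mono β h g⁻¹)
  map_one' := by
    ext x
    exact ε.actMap_one β h x
  map_mul' g k := by
    ext x
    exact ε.actMap_mul β h g k x

end Semidirect

/-- The inclusion of the free monoid `Ω*` in the free group `FG(Ω)`. -/
def freeInclusion (Ω : Type*) : FreeMonoid Ω →* FreeGroup Ω := FreeMonoid.lift FreeGroup.of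

/-- The inclusion of `X ⋊ T` in `X ⋊ G`. -/
def SemidirectProd.inclusion {X T G : Type*} [SemilatticeInf X] [Monoid T] [Group G]
    (j : T →* G) (β : G →* (X ≃o X)) (p : SemidirectProd (β.comp j)) : SemidirectProd β :=
  ⟨p.fst, j p.snd⟩

/-!
For `t` in `S/σ` let `m_t` be the greatest element of the `σ`-class `t`. Perfection makes `t ↦ m_t`
a homomorphism (`exists_maxSection`), and every `s` in the class `t` is `s⁺ m_t`. So `S` is encoded
by the partial action of `S/σ` on `P(S)` in which `t` acts by `A ↦ (m_t A)⁺`, an isomorphism from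
the principal ideal of `m_t^*` onto that of `m_t⁺`. When `S/σ` is free, sending each inverse letter
to the inverse partial isomorphism and composing along reduced words gives a partial action of the
free group, again by isomorphisms between principal ideals (`PartialAction.ofLetters`).

The semilattice `X` is the globalization of this partial action. An element `h · b` of it is
determined by the meets of its translates `g h · b` with the identity of `P(S)`, so `X` can be
realised as a set of functions from the group to `P(S)` with pointwise meets, the group acting by
translation (`PartialAction.Globalization`, `PartialAction.globalAction`). It is closed under meets
because domains are principal ideals; `P(S)` sits in it as a principal ideal, and the global action
extends the partial one without adding new values inside `P(S)`
(`PartialAction.globalAction_embed_eq_iff`). The nice factorisation of a group element cuts its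
reduced word into maximal positive and negative blocks: as the action of a reduced word is the
composite of the actions of its parts, the range of the whole lies in the range of the first block
(`exists_niceList`).

A congruence `ρ` of `S` induces the pointwise congruence `traceCon ρ` on `X`, invariant under the
group and restricting to `ρ` on `P(S)`. If `ρ ⊆ σ`, then `ρ` is determined by `σ` and its
restriction to `P(S)`, and `S/ρ` embeds in the semidirect product over `X / traceCon ρ`. For
arbitrary `ρ`, the congruence of `X ⋊ Ω*` generated by `traceCon ρ` and by the replacements of
`v (sσ) w` by `v (s'σ) w`, with `s ρ s'` and matching first components, restricts to `ρ` on `S`. The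
point is `GroupModel.ExtStep.exists_con`: when such a replacement is applied to the image of an
element of `S`, that element is `ρ`-related to a product with the factor `s`, so the replacement is
already made by `ρ`.
-/

/-! ### Partial group actions on semilattices and their globalization -/

/-- A partial action of a group `G` on a semilattice `E` with greatest element, in which each `g`
acts by an isomorphism from a principal ideal `Iic d_g` onto a principal ideal `Iic r_g`. It is
encoded by total maps: `act g a` is the value of `g` at `a ⊓ d_g`. Hence `r_g = act g ⊤`,
`d_g = act g⁻¹ ⊤`, and `act_act` says that `g h` extends the composite of the partial maps `g` and
`h`. -/
structure PartialAction (G E : Type*) [Group G] [SemilatticeInf E] [OrderTop E] where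
  act : G → E → E
  act_inf : ∀ g a b, act g (a ⊓ b) = act g a ⊓ act g b
  act_one : ∀ a, act 1 a = a
  act_act : ∀ g h a, act g (act h a) = act g ⊤ ⊓ act (g * h) a

namespace PartialAction

variable {G E : Type*} [Group G] [SemilatticeInf E] [OrderTop E] (τ : PartialAction G E)

theorem act_mono (g : G) : Monotone (τ.act g) := fun a b h => by
  rw [← inf_eq_left] at h ⊢
  rw [← τ.act_inf, h]

theorem act_le_act_top (g : G) (a : E) : τ.act g a ≤ τ.act g ⊤ := τ.act_mono g le_top

theorem act_act_le (g h : G) (a : E) : τ.act g (τ.act h a) ≤ τ.act (g * h) a :=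
  (τ.act_act g h a).le.trans inf_le_right

/-- The only partial inverse of `act g` is `act g⁻¹`. -/
theorem act_inv_eq {g : G} {p q : E → E} (hp : ∀ a, τ.act g a = p a)
    (hpq : ∀ a, p (q a) = a ⊓ p ⊤) (hqp : ∀ a, q (p a) = a ⊓ q ⊤) (hq : Monotone q) (b : E) :
    τ.act g⁻¹ b = q b := by
  have h1 : ∀ a, p (τ.act g⁻¹ a) = a ⊓ p ⊤ := fun a => by
    rw [← hp, τ.act_act, mul_inv_cancel, τ.act_one, inf_comm, hp]
  have h2 : ∀ a, τ.act g⁻¹ (p a) = a ⊓ τ.act g⁻¹ ⊤ := fun a => by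
    rw [← hp, τ.act_act, inv_mul_cancel, τ.act_one, inf_comm]
  apply le_antisymm
  · have h := h2 (q b)
    rw [hpq, ← h1, h2, inf_eq_left.2 (τ.act_le_act_top _ _)] at h
    exact h.le.trans inf_le_left
  · have h := hqp (τ.act g⁻¹ b)
    rw [h1, ← hpq, hqp, inf_eq_left.2 (hq le_top)] at h
    exact h.le.trans inf_le_left

/-- The globalization of a partial action, realised inside the semilattice `G → E` with pointwise
meets: its elements are the functions `g ↦ act (g * h) b`. Such a function stands for the element
`h · b` of the globalization; its value at `g` is the meet of `(g * h) · b` with `⊤ : E`. -/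
def Globalization : Type _ :=
  {f : G → E // ∃ (h : G) (b : E), ∀ g, f g = τ.act (g * h) b}

variable {τ} in
/-- The underlying function of an element of the globalization. -/
def Globalization.val (x : τ.Globalization) : G → E := Subtype.val x

variable {τ} in
theorem Globalization.exists_val_eq (x : τ.Globalization) :
    ∃ (h : G) (b : E), ∀ g, x.val g = τ.act (g * h) b := Subtype.property x

theorem inf_mem_globalization {x y : G → E} (hx : ∃ (h : G) (b : E), ∀ g, x g = τ.act (g * h) b)
    (hy : ∃ (h : G) (b : E), ∀ g, y g = τ.act (g * h) b) :
    ∃ (h : G) (b : E), ∀ g, (x ⊓ y) g = τ.act (g * h) b := by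
  obtain ⟨h, b, hx⟩ := hx
  obtain ⟨k, c, hy⟩ := hy
  refine ⟨h, b ⊓ τ.act (h⁻¹ * k) c, fun g => ?_⟩
  rw [Pi.inf_apply, hx, hy, τ.act_inf, τ.act_act, ← inf_assoc,
    inf_eq_left.2 (τ.act_le_act_top _ _)]
  congr 2
  group

instance : SemilatticeInf τ.Globalization :=
  Subtype.semilatticeInf fun _ _ hx hy => τ.inf_mem_globalization hx hy

variable {τ}

theorem Globalization.ext {x y : τ.Globalization} (h : ∀ g, x.val g = y.val g) : x = y :=
  Subtype.ext (funext h)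

theorem Globalization.inf_val (x y : τ.Globalization) (g : G) :
    (x ⊓ y).val g = x.val g ⊓ y.val g := rfl

variable (τ)

/-- Right translation of functions by `k`, which takes `h · b` to `(k * h) · b`. -/
def translate (k : G) (x : τ.Globalization) : τ.Globalization :=
  ⟨fun g => x.val (g * k), by
    obtain ⟨h, b, hx⟩ := x.exists_val_eq
    exact ⟨k * h, b, fun g => (hx _).trans (by rw [mul_assoc])⟩⟩

theorem translate_mono (k : G) : Monotone (τ.translate k) := fun _ _ h g => h (g * k)

/-- The action of `G` on the globalization. -/
def globalAction : G →* (τ.Globalization ≃o τ.Globalization) where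
  toFun k := (Equiv.mk (τ.translate k) (τ.translate k⁻¹)
      (fun x => Globalization.ext fun g => congrArg x.val (inv_mul_cancel_right g k))
      (fun x => Globalization.ext fun g => congrArg x.val (mul_inv_cancel_right g k))).toOrderIso
    (τ.translate_mono k) (τ.translate_mono k⁻¹)
  map_one' := by
    ext x
    exact Globalization.ext fun g => congrArg x.val (mul_one g)
  map_mul' k l := by
    ext x
    exact Globalization.ext fun g => congrArg x.val (mul_assoc g k l).symm

theorem globalAction_val (k : G) (x : τ.Globalization) (g : G) :
    (τ.globalAction k x).val g = x.val (g * k) := rfl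

/-- The embedding of `E` in the globalization. -/
def embed (a : E) : τ.Globalization :=
  ⟨fun g => τ.act g a, 1, a, fun g => by rw [mul_one]⟩

theorem embed_val (a : E) (g : G) : (τ.embed a).val g = τ.act g a := rfl

theorem embed_injective : Function.Injective τ.embed := fun a b h => by
  have := congrFun (congrArg Globalization.val h) 1
  rwa [embed_val, embed_val, τ.act_one, τ.act_one] at this

theorem embed_inf (a b : E) : τ.embed (a ⊓ b) = τ.embed a ⊓ τ.embed b :=
  Globalization.ext fun g => τ.act_inf g a b

theorem embed_mono : Monotone τ.embed := fun _ _ h g => τ.act_mono g h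

theorem embed_inf_globalAction (a b : E) (g : G) :
    τ.embed a ⊓ τ.globalAction g (τ.embed b) = τ.embed (a ⊓ τ.act g b) :=
  Globalization.ext fun h => by
    rw [Globalization.inf_val, globalAction_val, embed_val, embed_val, embed_val, τ.act_inf,
      τ.act_act, ← inf_assoc, inf_eq_left.2 (τ.act_le_act_top h a)]

theorem exists_eq_globalAction_embed (x : τ.Globalization) :
    ∃ (h : G) (b : E), x = τ.globalAction h (τ.embed b) := by
  obtain ⟨h, b, hx⟩ := x.exists_val_eq
  exact ⟨h, b, Globalization.ext hx⟩

/-- Meeting with an element of `E` leads back to `E`; the value at `1` is the meet with `⊤ : E`. -/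
theorem embed_inf_eq (a : E) (x : τ.Globalization) : τ.embed a ⊓ x = τ.embed (a ⊓ x.val 1) := by
  obtain ⟨h, b, rfl⟩ := τ.exists_eq_globalAction_embed x
  rw [embed_inf_globalAction, globalAction_val, embed_val, one_mul]

theorem range_embed : Set.range τ.embed = Set.Iic (τ.embed ⊤) := by
  ext x
  constructor
  · rintro ⟨a, rfl⟩
    exact τ.embed_mono le_top
  · intro hx
    refine ⟨x.val 1, ?_⟩
    rw [← top_inf_eq (x.val 1), ← embed_inf_eq]
    exact inf_eq_right.2 hx

/-- In the globalization, `g · a` lies in `E` only if `a` is in the domain of the partial map `g`: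
the global action extends the partial one and no more of it becomes defined inside `E`. -/
theorem globalAction_embed_eq_iff (g : G) (a b : E) :
    τ.globalAction g (τ.embed a) = τ.embed b ↔ a ≤ τ.act g⁻¹ ⊤ ∧ τ.act g a = b := by
  constructor
  · intro h
    have hv : ∀ k, τ.act (k * g) a = τ.act k b := fun k => congrFun (congrArg Globalization.val h) k
    constructor
    · have := hv g⁻¹
      rw [inv_mul_cancel, τ.act_one] at this
      exact this.le.trans (τ.act_le_act_top _ _)
    · simpa only [one_mul, τ.act_one] using hv 1
  · rintro ⟨ha, rfl⟩
    refine Globalization.ext fun k => ?_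
    rw [globalAction_val, embed_val, embed_val, τ.act_act, eq_comm, inf_eq_right]
    have h1 : a = τ.act g⁻¹ (τ.act g a) := by
      rw [τ.act_act, inv_mul_cancel, τ.act_one, inf_eq_right.2 ha]
    calc τ.act (k * g) a = τ.act (k * g) (τ.act g⁻¹ (τ.act g a)) := by rw [← h1]
      _ ≤ τ.act (k * g * g⁻¹) (τ.act g a) := τ.act_act_le _ _ _
      _ = τ.act k (τ.act g a) := by rw [mul_inv_cancel_right]
      _ ≤ τ.act k ⊤ := τ.act_le_act_top _ _

end PartialAction

/-! ### Partial actions of free groups -/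

section FreeGroup

open FreeGroup

variable {Ω E : Type*}

/-- The composite of maps, one for each letter, along a word. -/
def wordAct (f : Ω × Bool → E → E) (L : List (Ω × Bool)) (a : E) : E := L.foldr f a

theorem freeInclusion_eq_mk (t : FreeMonoid Ω) :
    freeInclusion Ω t = FreeGroup.mk (t.toList.map fun x => (x, true)) := by
  induction t using FreeMonoid.inductionOn' with
  | one => exact _root_.map_one _
  | of_mul x t ih =>
    rw [_root_.map_mul, ih, freeInclusion, FreeMonoid.lift_eval_of, FreeGroup.of, FreeGroup.mul_mk]
    rfl

open scoped Classical in
theorem toWord_freeInclusion (t : FreeMonoid Ω) :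
    (freeInclusion Ω t).toWord = t.toList.map fun x => (x, true) := by
  rw [freeInclusion_eq_mk, toWord_mk, ← isReduced_iff_reduce_eq, FreeGroup.IsReduced,
    List.isChain_map]
  exact List.Pairwise.isChain (List.pairwise_of_forall fun _ _ _ => rfl)

theorem freeInclusion_injective : Function.Injective (freeInclusion Ω) := by
  classical
  intro s t h
  have := congrArg toWord h
  rw [toWord_freeInclusion, toWord_freeInclusion] at this
  exact FreeMonoid.toList.injective
    (List.map_injective_iff.2 (fun _ _ h => congrArg Prod.fst h) this)

open scoped Classical in
/-- Multiplying a reduced word by a letter on the left either prepends that letter or cancels it. -/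
theorem toWord_letter_mul (l : Ω × Bool) (g : FreeGroup Ω) :
    (FreeGroup.mk [l] * g).toWord = l :: g.toWord ∨
      g.toWord = (l.1, !l.2) :: (FreeGroup.mk [l] * g).toWord := by
  have h : (FreeGroup.mk [l] * g).toWord = reduce (l :: g.toWord) := by
    conv_lhs => rw [← mk_toWord (x := g), mul_mk, toWord_mk]
    rfl
  rw [h, reduce.cons, reduce_toWord]
  rcases hg : g.toWord with _ | ⟨k, L⟩
  · left; rfl
  · by_cases hk : l.1 = k.1 ∧ l.2 = !k.2
    · right
      simp only [hk, and_self, if_true, Bool.not_not, Prod.mk.eta]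
    · left
      simp only [hk, if_false]

theorem wordAct_inf [SemilatticeInf E] {f : Ω × Bool → E → E}
    (hf : ∀ l a b, f l (a ⊓ b) = f l a ⊓ f l b)
    (L : List (Ω × Bool)) (a b : E) : wordAct f L (a ⊓ b) = wordAct f L a ⊓ wordAct f L b := by
  induction L with
  | nil => rfl
  | cons l L ih => exact (congrArg (f l) ih).trans (hf l _ _)

variable [SemilatticeInf E] [OrderTop E]

open scoped Classical in
/-- The case of a single letter in the composition law of `PartialAction.ofLetters`. -/
theorem letter_wordAct {f : Ω × Bool → E → E} (hf : ∀ l a b, f l (a ⊓ b) = f l a ⊓ f l b)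
    (hinv : ∀ l a, f l (f (l.1, !l.2) a) = a ⊓ f l ⊤) (l : Ω × Bool) (g : FreeGroup Ω) (a : E) :
    f l (wordAct f g.toWord a) = f l ⊤ ⊓ wordAct f (FreeGroup.mk [l] * g).toWord a := by
  rcases toWord_letter_mul l g with h | h
  · rw [h, eq_comm, wordAct, List.foldr_cons, ← hf, top_inf_eq]
    rfl
  · conv_lhs => rw [h]
    exact (hinv l _).trans (inf_comm _ _)

open scoped Classical in
/-- Partial isomorphisms between principal ideals, one for each letter and mutually inverse for
inverse letters, give a partial action of the free group: `g` acts by the composite along its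
reduced word. -/
noncomputable def PartialAction.ofLetters (f : Ω × Bool → E → E)
    (hf : ∀ l a b, f l (a ⊓ b) = f l a ⊓ f l b)
    (hinv : ∀ l a, f l (f (l.1, !l.2) a) = a ⊓ f l ⊤) : PartialAction (FreeGroup Ω) E where
  act g a := wordAct f g.toWord a
  act_inf g := wordAct_inf hf g.toWord
  act_one a := by rw [toWord_one]; rfl
  act_act g h a := by
    have key : ∀ L : List (Ω × Bool), wordAct f L (wordAct f h.toWord a)
        = wordAct f L ⊤ ⊓ wordAct f (FreeGroup.mk L * h).toWord a := by
      intro L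
      induction L with
      | nil =>
        rw [← FreeGroup.one_eq_mk, one_mul]
        exact (top_inf_eq _).symm
      | cons l L ih =>
        have h1 : f l (wordAct f L (wordAct f h.toWord a)) = _ := congrArg (f l) ih
        have h2 : f l (wordAct f L ⊤) ≤ f l ⊤ := by
          rw [← inf_eq_left, ← hf, inf_top_eq]
        rw [hf, letter_wordAct hf hinv, ← inf_assoc, inf_eq_left.2 h2, ← mul_assoc, mul_mk] at h1
        exact h1
    have := key g.toWord
    rwa [mk_toWord] at this

/-- The restriction of `PartialAction.ofLetters` to the free monoid. -/
theorem PartialAction.ofLetters_freeInclusion (f : Ω × Bool → E → E)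
    (hf : ∀ l a b, f l (a ⊓ b) = f l a ⊓ f l b)
    (hinv : ∀ l a, f l (f (l.1, !l.2) a) = a ⊓ f l ⊤) (t : FreeMonoid Ω) (a : E) :
    (PartialAction.ofLetters f hf hinv).act (freeInclusion Ω t) a
      = t.toList.foldr (fun x => f (x, true)) a := by
  classical
  change wordAct f (toWord _) a = _
  rw [toWord_freeInclusion, wordAct, List.foldr_map]

/-- Relations preserved by the letters are preserved by the whole free group. -/
theorem PartialAction.ofLetters_rel {f : Ω × Bool → E → E}
    (hf : ∀ l a b, f l (a ⊓ b) = f l a ⊓ f l b)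
    (hinv : ∀ l a, f l (f (l.1, !l.2) a) = a ⊓ f l ⊤) {r : E → E → Prop}
    (hr : ∀ l a b, r a b → r (f l a) (f l b)) (g : FreeGroup Ω) {a b : E} (hab : r a b) :
    r ((PartialAction.ofLetters f hf hinv).act g a)
      ((PartialAction.ofLetters f hf hinv).act g b) := by
  classical
  change r (wordAct f (toWord g) a) (wordAct f (toWord g) b)
  induction toWord g with
  | nil => exact hab
  | cons l L ih => exact hr l _ _ ih

end FreeGroup

/-! ### Nice factorisations -/

section Nice

variable {T G E X : Type*} [Monoid T] [Group G] [SemilatticeInf E] [OrderTop E] [SemilatticeInf X]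

/-- `NiceList j τ ε w` says that the factors of `w` lie in `T` and `T⁻¹` alternately, starting with
the sign `ε`, and that the range of the product of each nonempty tail of `w` is contained in the
range of the first factor of that tail. -/
inductive NiceList (j : T →* G) (τ : PartialAction G E) : ℤˣ → List G → Prop
  | nil (ε : ℤˣ) : NiceList j τ ε []
  | cons (ε : ℤˣ) (t : T) (w : List G) (hw : NiceList j τ (-ε) w)
      (h : τ.act (j t ^ (ε : ℤ) * w.prod) ⊤ ≤ τ.act (j t ^ (ε : ℤ)) ⊤) :
      NiceList j τ ε (j t ^ (ε : ℤ) :: w)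

theorem NiceList.exists_getElem {j : T →* G} {τ : PartialAction G E} {ε : ℤˣ} {w : List G}
    (hw : NiceList j τ ε w) (i : ℕ) (hi : i < w.length) :
    ∃ t : T, w[i] = j t ^ ((ε * (-1) ^ i : ℤˣ) : ℤ) := by
  induction hw generalizing i with
  | nil => simp at hi
  | cons ε t w hw h ih =>
    cases i with
    | zero => exact ⟨t, by simp⟩
    | succ i =>
      obtain ⟨t, ht⟩ := ih i (by simpa using hi)
      exact ⟨t, by rw [List.getElem_cons_succ, ht, pow_succ']; simp⟩

theorem NiceList.act_drop_le {j : T →* G} {τ : PartialAction G E} {ε : ℤˣ} {w : List G}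
    (hw : NiceList j τ ε w) (i : ℕ) (hi : i < w.length) :
    τ.act (w.drop i).prod ⊤ ≤ τ.act w[i] ⊤ := by
  induction hw generalizing i with
  | nil => simp at hi
  | cons ε t w hw h ih =>
    cases i with
    | zero => simpa using h
    | succ i => simpa using ih i (by simpa using hi)

theorem NiceList.isAlternating {j : T →* G} {τ : PartialAction G E} {ε : ℤˣ} {w : List G}
    (hw : NiceList j τ ε w) : IsAlternating j w := by
  choose t ht using fun i : Fin w.length => hw.exists_getElem i i.2
  refine ⟨t, fun i => ε * (-1) ^ (i : ℕ), ht, fun i k => ?_⟩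
  rw [mul_right_inj]
  have h1 : (-1 : ℤˣ) ≠ 1 := by decide
  have h2 : (1 : ℤˣ) ≠ -1 := by decide
  rcases Nat.even_or_odd (i : ℕ) with hi | hi <;> rcases Nat.even_or_odd (k : ℕ) with hk | hk
  · simp only [hi.neg_one_pow, hk.neg_one_pow, true_iff]
    obtain ⟨a, ha⟩ := hi; obtain ⟨b, hb⟩ := hk; omega
  · simp only [hi.neg_one_pow, hk.neg_one_pow, h2, false_iff]
    obtain ⟨a, ha⟩ := hi; obtain ⟨b, hb⟩ := hk; omega
  · simp only [hi.neg_one_pow, hk.neg_one_pow, h1, false_iff]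
    obtain ⟨a, ha⟩ := hi; obtain ⟨b, hb⟩ := hk; omega
  · simp only [hi.neg_one_pow, hk.neg_one_pow, true_iff]
    obtain ⟨a, ha⟩ := hi; obtain ⟨b, hb⟩ := hk; omega

theorem NiceList.isNiceFactorisation {j : T →* G} {τ : PartialAction G E} {ε : ℤˣ} {w : List G}
    (hw : NiceList j τ ε w) (hne : w ≠ []) :
    IsNiceFactorisation j τ.globalAction (τ.embed ⊤) w.prod w := by
  refine ⟨hne, rfl, hw.isAlternating, fun i _ => ?_⟩
  rw [τ.embed_inf_globalAction, top_inf_eq]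
  calc τ.embed (τ.act (w.drop i).prod ⊤) ≤ τ.embed (⊤ ⊓ τ.act (w.get i) ⊤) := by
        rw [top_inf_eq]
        exact τ.embed_mono (hw.act_drop_le i i.2)
    _ ≤ τ.globalAction (w.get i) (τ.embed ⊤) := by
        rw [← τ.embed_inf_globalAction]
        exact inf_le_right

end Nice

section FreeNice

open FreeGroup

variable {Ω E : Type*} [SemilatticeInf E] [OrderTop E]

/-- The maximal positive and negative blocks of a reduced word, up to a trivial last factor, form a
nice factorisation: along a reduced word there is no cancellation, so the range of the whole is
contained in the range of its first block. The blocks are built up by adding the letters one by one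
on the left. -/
theorem exists_niceList {f : Ω × Bool → E → E} (hf : ∀ l a b, f l (a ⊓ b) = f l a ⊓ f l b)
    (hinv : ∀ l a, f l (f (l.1, !l.2) a) = a ⊓ f l ⊤) (g : FreeGroup Ω) :
    ∃ ε w, w ≠ [] ∧ w.prod = g ∧
      NiceList (freeInclusion Ω) (PartialAction.ofLetters f hf hinv) ε w := by
  classical
  set τ := PartialAction.ofLetters f hf hinv with hτ
  have key : ∀ L : List (Ω × Bool), FreeGroup.IsReduced L →
      ∃ ε w, w ≠ [] ∧ w.prod = FreeGroup.mk L ∧ NiceList (freeInclusion Ω) τ ε w := by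
    intro L
    induction L with
    | nil =>
      intro _
      refine ⟨1, [freeInclusion Ω 1 ^ ((1 : ℤˣ) : ℤ)], by simp, by simp [FreeGroup.one_eq_mk],
        .cons _ _ _ (.nil _) (by simp)⟩
    | cons l L ih =>
      intro hL
      have hL' : FreeGroup.IsReduced L := hL.infix ⟨[l], [], by simp⟩
      obtain ⟨ε, w, hne, hprod, hw⟩ := ih hL'
      obtain ⟨x, b⟩ := l
      set δ : ℤˣ := if b then 1 else -1 with hδ
      have hl : freeInclusion Ω (FreeMonoid.of x) ^ (δ : ℤ) = FreeGroup.mk [(x, b)] := by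
        rw [freeInclusion, FreeMonoid.lift_eval_of]
        cases b <;> simp [hδ, FreeGroup.of, FreeGroup.inv_mk, FreeGroup.invRev]
      -- as the word is reduced, its action is the composite of the actions of its parts
      have hact : ∀ a, τ.act (FreeGroup.mk ((x, b) :: L)) a
          = τ.act (FreeGroup.mk [(x, b)]) (τ.act (FreeGroup.mk L) a) := by
        intro a
        change wordAct f _ a = wordAct f _ (wordAct f _ a)
        rw [toWord_mk, toWord_mk, toWord_mk, isReduced_iff_reduce_eq.1 hL,
          isReduced_iff_reduce_eq.1 hL']
        rfl
      have hmk : FreeGroup.mk ((x, b) :: L) = FreeGroup.mk [(x, b)] * FreeGroup.mk L := by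
        rw [mul_mk]; rfl
      by_cases hε : ε = δ
      · cases hw with
        | nil => exact absurd rfl hne
        | cons _ t w hw h =>
          rw [List.prod_cons] at hprod
          obtain ⟨t', ht'⟩ : ∃ t', freeInclusion Ω t' ^ (ε : ℤ)
              = FreeGroup.mk [(x, b)] * freeInclusion Ω t ^ (ε : ℤ) := by
            rw [← hl, hε]
            rcases Int.units_eq_one_or δ with h | h
            · exact ⟨FreeMonoid.of x * t, by simp [h]⟩
            · exact ⟨t * FreeMonoid.of x, by simp [h]⟩
          refine ⟨ε, freeInclusion Ω t' ^ (ε : ℤ) :: w, by simp, ?_, .cons _ _ _ hw ?_⟩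
          · rw [List.prod_cons, ht', mul_assoc, hprod, hmk]
          · rw [ht', mul_assoc, hprod, ← hmk, hact]
            refine (τ.act_mono _ ?_).trans (τ.act_act_le _ _ _)
            rw [← hprod]
            exact h
      · have hε' : ε = -δ := by
          rcases Int.units_eq_one_or δ with h | h <;>
            rcases Int.units_eq_one_or ε with h' | h' <;> simp_all
        subst hε'
        refine ⟨δ, freeInclusion Ω (FreeMonoid.of x) ^ (δ : ℤ) :: w, by simp, ?_,
          .cons _ _ _ hw ?_⟩
        · rw [List.prod_cons, hl, hprod, hmk]
        · rw [hl, hprod, ← hmk, hact]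
          exact τ.act_le_act_top _ _
  obtain ⟨ε, w, hw⟩ := key g.toWord isReduced_toWord
  rw [mk_toWord] at hw
  exact ⟨ε, w, hw⟩

end FreeNice
/-! ### The actions of a restriction semigroup on its projections -/

section Projections

variable {S : Type*} [RestrictionSemigroup S]

theorem isProj_rplus (x : S) : IsProj (rplus x) := ⟨x, rfl⟩

theorem isProj_rstar (x : S) : IsProj (rstar x) := ⟨rstar x, rplus_rstar x⟩

theorem IsProj.rplus_eq {e : S} (he : IsProj e) : rplus e = e := by
  obtain ⟨x, rfl⟩ := he
  rw [← rstar_rplus x]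
  exact rplus_rstar _

theorem IsProj.rstar_eq {e : S} (he : IsProj e) : rstar e = e := by
  obtain ⟨x, rfl⟩ := he
  exact rstar_rplus x

theorem IsProj.comm {e f : S} (he : IsProj e) (hf : IsProj f) : e * f = f * e := by
  obtain ⟨x, rfl⟩ := he
  obtain ⟨y, rfl⟩ := hf
  exact rplus_comm x y

theorem IsProj.mul_self {e : S} (he : IsProj e) : e * e = e := by
  obtain ⟨x, rfl⟩ := he
  exact rplus_idem x

theorem IsProj.rplus_mul {e : S} (he : IsProj e) (x : S) : rplus (e * x) = e * rplus x := by
  obtain ⟨y, rfl⟩ := he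
  exact rplus_rplus_mul y x

theorem IsProj.rstar_mul_right {e : S} (he : IsProj e) (x : S) : rstar (x * e) = rstar x * e := by
  have h := rstar_mul_rstar x e
  rwa [he.rstar_eq] at h

theorem IsProj.mul_eq {e : S} (he : IsProj e) (x : S) : x * e = rplus (x * e) * x := by
  have h := mul_rplus x e
  rwa [he.rplus_eq] at h

theorem IsProj.mul_eq' {e : S} (he : IsProj e) (x : S) : e * x = x * rstar (e * x) := by
  have h := rstar_mul x e
  rwa [he.rstar_eq] at h

theorem rplus_mul_rplus (x y : S) : rplus (x * rplus y) = rplus (x * y) := by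
  rw [mul_rplus, rplus_rplus_mul, rplus_comm, ← rplus_rplus_mul, ← mul_assoc, rplus_mul_self]

theorem IsProj.rplus_mul_mul {a : S} (ha : IsProj a) (s b : S) :
    rplus (s * (a * b)) = rplus (s * a) * rplus (s * b) := by
  rw [← rplus_rplus_mul, ← mul_assoc, ← mul_assoc, ← ha.mul_eq]

theorem IsProj.rstar_mul_mul {b : S} (hb : IsProj b) (s a : S) :
    rstar (a * b * s) = rstar (a * s) * rstar (b * s) := by
  rw [← rstar_mul_rstar, mul_assoc a s, ← hb.mul_eq', mul_assoc]

/-- The map `A ↦ (s A)⁺` on projections. -/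
def leftAct (s : S) (A : Proj S) : Proj S := projPlus (s * A.1)

/-- The map `A ↦ (A s)^*` on projections. -/
def rightAct (s : S) (A : Proj S) : Proj S := projStar (A.1 * s)

theorem leftAct_inf (s : S) (A B : Proj S) : leftAct s (A ⊓ B) = leftAct s A ⊓ leftAct s B :=
  Subtype.ext (IsProj.rplus_mul_mul A.2 s B.1)

theorem rightAct_inf (s : S) (A B : Proj S) : rightAct s (A ⊓ B) = rightAct s A ⊓ rightAct s B :=
  Subtype.ext (IsProj.rstar_mul_mul B.2 s A.1)

theorem leftAct_mul (s t : S) (A : Proj S) : leftAct (s * t) A = leftAct s (leftAct t A) :=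
  Subtype.ext <| by
    change rplus (s * t * A.1) = rplus (s * rplus (t * A.1))
    rw [rplus_mul_rplus, mul_assoc]

theorem leftAct_rightAct (s : S) (A : Proj S) :
    leftAct s (rightAct s A) = A ⊓ projPlus s := by
  obtain ⟨a, ha⟩ := A
  refine Subtype.ext ?_
  change rplus (s * rstar (a * s)) = a * rplus s
  rw [← ha.mul_eq', ha.rplus_mul]

theorem rightAct_leftAct (s : S) (A : Proj S) :
    rightAct s (leftAct s A) = A ⊓ projStar s := by
  obtain ⟨a, ha⟩ := A
  refine Subtype.ext ?_
  change rstar (rplus (s * a) * s) = a * rstar s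
  rw [← ha.mul_eq, ha.rstar_mul_right, (isProj_rstar s).comm ha]

theorem rightAct_mono (s : S) : Monotone (rightAct s) := fun A B h => by
  rw [← inf_eq_left] at h ⊢
  rw [← rightAct_inf, h]

theorem RestrictionCon.leftAct (ρ : RestrictionCon S) (s : S) {A B : Proj S}
    (h : ρ.r A.1 B.1) : ρ.r (leftAct s A).1 (leftAct s B).1 :=
  ρ.rplus' (ρ.mul' (ρ.refl' s) h)

theorem RestrictionCon.rightAct (ρ : RestrictionCon S) (s : S) {A B : Proj S}
    (h : ρ.r A.1 B.1) : ρ.r (rightAct s A).1 (rightAct s B).1 :=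
  ρ.rstar' (ρ.mul' h (ρ.refl' s))

end Projections

/-! ### Perfect restriction monoids -/

section Perfect

variable {S : Type*} [RestrictionMonoid S]

theorem isProj_one : IsProj (1 : S) := (projOne S).2

instance : OrderTop (Proj S) where
  top := projOne S
  le_top A := inf_eq_left.1 (Subtype.ext (mul_one A.1))

theorem leftAct_top (s : S) : leftAct s ⊤ = projPlus s :=
  Subtype.ext (congrArg rplus (mul_one s))

theorem rightAct_top (s : S) : rightAct s ⊤ = projStar s :=
  Subtype.ext (congrArg rstar (one_mul s))

theorem leftAct_one (A : Proj S) : leftAct 1 A = A := by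
  obtain ⟨a, ha⟩ := A
  refine Subtype.ext ?_
  change rplus (1 * a) = a
  rw [one_mul, ha.rplus_eq]

variable (S) in
/-- A presentation of the factor monoid of `S` by `σ` as a monoid `M`, together with a homomorphism
`sec : M → S` that takes every `σ`-class to its greatest element. -/
structure MaxSection (M : Type*) [Monoid M] where
  cl : S →* M
  cl_eq_iff : ∀ a b, cl a = cl b ↔ sigma S a b
  sec : M →* S
  cl_sec : ∀ t, cl (sec t) = t
  eq_rplus_mul_sec : ∀ s, s = rplus s * sec (cl s)

namespace MaxSection

variable {M : Type*} [Monoid M] (m : MaxSection S M)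

theorem cl_proj {e : S} (he : IsProj e) : m.cl e = 1 := by
  rw [← map_one m.cl, m.cl_eq_iff]
  exact ⟨e, he, by rw [he.mul_self, mul_one]⟩

theorem cl_proj_mul {e : S} (he : IsProj e) (s : S) : m.cl (e * s) = m.cl s := by
  rw [map_mul, m.cl_proj he, one_mul]

theorem cl_mul_proj {e : S} (he : IsProj e) (s : S) : m.cl (s * e) = m.cl s := by
  rw [map_mul, m.cl_proj he, mul_one]

/-- An element is determined by its `σ`-class and its projection `s⁺`, also modulo a congruence. -/
theorem con_of_cl_eq (ρ : RestrictionCon S) {a b : S} (h : m.cl a = m.cl b)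
    (h' : ρ.r (rplus a) (rplus b)) : ρ.r a b := by
  rw [m.eq_rplus_mul_sec a, m.eq_rplus_mul_sec b, h]
  exact ρ.mul' h' (ρ.refl' _)

theorem eq_of_cl_eq {a b : S} (h : m.cl a = m.cl b) (h' : rplus a = rplus b) : a = b := by
  rw [m.eq_rplus_mul_sec a, m.eq_rplus_mul_sec b, h, h']

theorem eq_sec_mul_rstar (s : S) : s = m.sec (m.cl s) * rstar s := by
  conv_lhs => rw [m.eq_rplus_mul_sec s, (isProj_rplus s).mul_eq', ← m.eq_rplus_mul_sec]

theorem leftAct_sec_cl_projStar (s : S) : leftAct (m.sec (m.cl s)) (projStar s) = projPlus s :=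
  Subtype.ext (congrArg rplus (m.eq_sec_mul_rstar s).symm)

theorem rightAct_sec_cl_projPlus (s : S) : rightAct (m.sec (m.cl s)) (projPlus s) = projStar s :=
  Subtype.ext (congrArg rstar (m.eq_rplus_mul_sec s).symm)

end MaxSection

/-- In a perfect restriction monoid the greatest elements of the `σ`-classes are closed under
multiplication: perfection writes the greatest element of a product class as a product of elements
of the two classes, which lies below the product of their greatest elements. -/
theorem exists_maxSection (hS : IsPerfectRestrictionMonoid S) {M : Type*} [Monoid M]
    (φ : (sigma S).Quotient ≃* M) :
    ∃ m : MaxSection S M, ∀ s : S, m.cl s = φ (s : (sigma S).Quotient) := by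
  obtain ⟨hperf, hmax⟩ := hS
  have hcl_mul : ∀ a b : S, φ ((a * b : S) : (sigma S).Quotient)
      = φ (a : (sigma S).Quotient) * φ (b : (sigma S).Quotient) := fun a b =>
    map_mul φ (a : (sigma S).Quotient) (b : (sigma S).Quotient)
  have hcl_iff : ∀ a b : S, φ (a : (sigma S).Quotient) = φ (b : (sigma S).Quotient) ↔
      sigma S a b := fun a b => φ.injective.eq_iff.trans (Con.eq _)
  have hsurj : ∀ t, ∃ a : S, φ (a : (sigma S).Quotient) = t := fun t => by
    obtain ⟨q, rfl⟩ := φ.surjective t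
    obtain ⟨a, rfl⟩ := Quotient.exists_rep q
    exact ⟨a, rfl⟩
  have hcl_one : φ ((1 : S) : (sigma S).Quotient) = 1 := by
    obtain ⟨a, ha⟩ := hsurj 1
    rw [← mul_one (φ _), ← ha, ← hcl_mul, one_mul]
  have hmax' : ∀ t, ∃ x : S, φ (x : (sigma S).Quotient) = t ∧
      ∀ b : S, φ (b : (sigma S).Quotient) = t → b = rplus b * x := fun t => by
    obtain ⟨a, rfl⟩ := hsurj t
    obtain ⟨x, hx, hb⟩ := hmax a
    exact ⟨x, ((hcl_iff _ _).2 hx).symm, fun b h => hb b ((hcl_iff _ _).1 h.symm)⟩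
  choose top htop hle using hmax'
  have htop_one : top 1 = 1 := by
    have h := hle 1 1 hcl_one
    rw [isProj_one.rplus_eq, one_mul] at h
    exact h.symm
  have htop_mul : ∀ t u, top (t * u) = top t * top u := by
    intro t u
    have h1 : top t * top u = rplus (top t * top u) * top (t * u) :=
      hle _ _ (by rw [hcl_mul, htop, htop])
    have h2 : sigma S (top t * top u) (top (t * u)) := by
      rw [← hcl_iff, hcl_mul, htop, htop, htop]
    have h3 : top (t * u) ∈ {z | sigma S (top t * top u) z} := h2
    rw [← hperf] at h3
    obtain ⟨x, hx, y, hy, hxy⟩ := h3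
    have hx' := hle t x (by rw [← (hcl_iff _ _).2 hx, htop])
    have hy' := hle u y (by rw [← (hcl_iff _ _).2 hy, htop])
    -- the product `x y` is a restriction of the product of the two greatest elements
    obtain ⟨f, hf, hfe⟩ : ∃ f : S, IsProj f ∧ top (t * u) = f * (top t * top u) := by
      refine ⟨rplus x * rplus (top t * rplus y), (isProj_rplus _).mul (isProj_rplus _), ?_⟩
      calc top (t * u) = x * y := hxy.symm
        _ = rplus x * top t * (rplus y * top u) := by rw [← hx', ← hy']
        _ = rplus x * (top t * rplus y) * top u := by simp only [mul_assoc]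
        _ = rplus x * (rplus (top t * rplus y) * top t) * top u := by
            rw [← (isProj_rplus y).mul_eq]
        _ = _ := by simp only [mul_assoc]
    rw [hfe, ← mul_assoc, (isProj_rplus _).comm hf, mul_assoc, rplus_mul_self, ← hfe] at h1
    exact h1.symm
  exact ⟨{
    cl := ⟨⟨fun s => φ (s : (sigma S).Quotient), hcl_one⟩, hcl_mul⟩
    cl_eq_iff := hcl_iff
    sec := ⟨⟨top, htop_one⟩, htop_mul⟩
    cl_sec := htop
    eq_rplus_mul_sec := fun s => hle _ s rfl }, fun _ => rfl⟩

end Perfect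
/-! ### Semidirect products -/

section SemidirectProd

variable {X T G : Type*} [SemilatticeInf X] [Monoid T] [Group G]

theorem orderIso_symm_eq_map_inv (β : G →* (X ≃o X)) (g : G) (x : X) : (β g).symm x = β g⁻¹ x := by
  rw [OrderIso.symm_apply_eq, ← RelIso.mul_apply, ← map_mul, mul_inv_cancel, map_one,
    RelIso.one_apply]

theorem semidirectProd_isInverseSemigroup (β : G →* (X ≃o X)) :
    IsInverseSemigroup (SemidirectProd β) := by
  have key : ∀ a b : SemidirectProd β, a * b * a = a → b * a * b = b →
      b = ⟨(β a.snd).symm a.fst, a.snd⁻¹⟩ := by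
    rintro ⟨a, g⟩ ⟨b, h⟩ h1 h2
    have h1s : g * h * g = g := congrArg SemidirectProd.snd h1
    have hh : h = g⁻¹ := by
      rw [mul_assoc, mul_eq_left] at h1s
      exact eq_inv_of_mul_eq_one_left h1s
    subst hh
    have h1f : a ⊓ β g b ⊓ β (g * g⁻¹) a = a := congrArg SemidirectProd.fst h1
    have h2f : b ⊓ β g⁻¹ a ⊓ β (g⁻¹ * g) b = b := congrArg SemidirectProd.fst h2
    refine SemidirectProd.ext (le_antisymm ?_ ?_) rfl
    · change b ≤ (β g).symm a
      rw [orderIso_symm_eq_map_inv]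
      exact (h2f.ge.trans inf_le_left).trans inf_le_right
    · change (β g).symm a ≤ b
      rw [OrderIso.symm_apply_le]
      exact (h1f.ge.trans inf_le_left).trans inf_le_right
  refine ⟨?_, ?_⟩
  · rintro ⟨a, g⟩
    refine ⟨⟨(β g).symm a, g⁻¹⟩, ⟨SemidirectProd.ext ?_ ?_, SemidirectProd.ext ?_ ?_⟩,
      fun b hb => key _ b hb.1 hb.2⟩
    · change a ⊓ β g ((β g).symm a) ⊓ β (g * g⁻¹) a = a
      simp
    · exact (by group : g * g⁻¹ * g = g)
    · change (β g).symm a ⊓ β g⁻¹ a ⊓ β (g⁻¹ * g) ((β g).symm a) = (β g).symm a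
      rw [← orderIso_symm_eq_map_inv, inv_mul_cancel, map_one, RelIso.one_apply, inf_idem, inf_idem]
    · exact (by group : g⁻¹ * g * g⁻¹ = g⁻¹)
  · rintro ⟨a, g⟩ b h1 h2
    have hb := key _ b h1 h2
    subst hb
    refine ⟨SemidirectProd.ext ?_ ?_, SemidirectProd.ext ?_ ?_⟩
    · change a = a ⊓ β g ((β g).symm a)
      simp
    · exact (mul_inv_cancel g).symm
    · change (β g).symm a = (β g).symm a ⊓ β g⁻¹ a
      rw [← orderIso_symm_eq_map_inv, inf_idem]
    · exact (inv_mul_cancel g).symm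

theorem SemidirectProd.inclusion_isRestrictionEmbedding {j : T →* G} (hj : Function.Injective j)
    (β : G →* (X ≃o X)) : IsRestrictionEmbedding (SemidirectProd.inclusion j β) where
  injective p q h := by
    have h1 := congrArg SemidirectProd.fst h
    have h2 := congrArg SemidirectProd.snd h
    exact SemidirectProd.ext h1 (hj h2)
  map_mul p q := SemidirectProd.ext rfl (map_mul j _ _)
  map_rplus p := SemidirectProd.ext rfl (map_one j)
  map_rstar p := SemidirectProd.ext rfl (map_one j)

namespace SemilatticeCon

variable (ε : SemilatticeCon X)

theorem cls_inf (x y : X) : ε.cls (x ⊓ y) = ε.cls x ⊓ ε.cls y := rfl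

theorem cls_mono : Monotone ε.cls := fun x y h => by
  rw [← inf_eq_left] at h ⊢
  rw [← cls_inf, h]

variable (β : G →* (X ≃o X)) (hε : ε.Invariant β)

theorem quotientAction_cls (g : G) (x : X) :
    ε.quotientAction β hε g (ε.cls x) = ε.cls (β g x) := rfl

/-- Niceness passes to factors of the semilattice, with the same nice factorisations. -/
theorem isNiceSemidirectProd_quotient {j : T →* G} {e : X} (h : IsNiceSemidirectProd j β e) :
    IsNiceSemidirectProd j (ε.quotientAction β hε) (ε.cls e) := by
  obtain ⟨hj, hnice, hcover⟩ := h
  refine ⟨hj, fun g => ?_, fun x => ?_⟩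
  · obtain ⟨w, hne, hprod, halt, hw⟩ := hnice g
    exact ⟨w, hne, hprod, halt, fun i hi => ε.cls_mono (hw i hi)⟩
  · induction x using Quotient.inductionOn with | _ x =>
    obtain ⟨g, y, hy, rfl⟩ := hcover x
    exact ⟨g, ε.cls y, ε.cls_mono hy, rfl⟩

/-- The morphism from `X ⋊ T` to `(X/ε) ⋊ T` induced by `x ↦ xε`. -/
def mapSemidirect (j : T →* G) (p : SemidirectProd (β.comp j)) :
    SemidirectProd ((ε.quotientAction β hε).comp j) := ⟨ε.cls p.fst, p.snd⟩

theorem mapSemidirect_rstar (j : T →* G) (p : SemidirectProd (β.comp j)) :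
    ε.mapSemidirect β hε j (rstar p) = rstar (ε.mapSemidirect β hε j p) := by
  refine SemidirectProd.ext ?_ rfl
  change ε.cls ((β (j p.snd)).symm p.fst)
    = (ε.quotientAction β hε (j p.snd)).symm (ε.cls p.fst)
  rw [orderIso_symm_eq_map_inv, orderIso_symm_eq_map_inv, quotientAction_cls]

end SemilatticeCon

end SemidirectProd

/-! ### Extensions to a group of the partial action on projections -/

/-- An extension to a group `G` of the partial action of `M` (the factor of `S` by `σ`) on `P(S)`,
along a homomorphism from `M` to `G`, such that the congruences of `S` are respected by all of
`G`. -/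
structure GroupModel {S M : Type*} [RestrictionMonoid S] [Monoid M] (m : MaxSection S M)
    (G : Type*) [Group G] where
  j : M →* G
  τ : PartialAction G (Proj S)
  act_j : ∀ t A, τ.act (j t) A = leftAct (m.sec t) A
  act_rel : ∀ (ρ : RestrictionCon S) (g : G) (A B : Proj S),
    ρ.r A.1 B.1 → ρ.r (τ.act g A).1 (τ.act g B).1

namespace GroupModel

variable {S M G : Type*} [RestrictionMonoid S] [Monoid M] [Group G] {m : MaxSection S M}
  (γ : GroupModel m G)

theorem act_j_inv (t : M) (A : Proj S) : γ.τ.act (γ.j t)⁻¹ A = rightAct (m.sec t) A :=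
  γ.τ.act_inv_eq (γ.act_j t) (fun B => by rw [leftAct_rightAct, leftAct_top])
    (fun B => by rw [rightAct_leftAct, rightAct_top]) (rightAct_mono _) A

theorem globalAction_embed_projStar (s : S) :
    γ.τ.globalAction (γ.j (m.cl s)) (γ.τ.embed (projStar s)) = γ.τ.embed (projPlus s) := by
  rw [γ.τ.globalAction_embed_eq_iff, γ.act_j_inv, γ.act_j]
  refine ⟨?_, m.leftAct_sec_cl_projStar s⟩
  rw [← m.rightAct_sec_cl_projPlus s]
  exact rightAct_mono _ le_top

/-- The global action restricted to `M` extends the partial action of `M` on `P(S)`. -/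
theorem globalAction_j_embed_eq_iff (t : M) (A B : Proj S) :
    γ.τ.globalAction (γ.j t) (γ.τ.embed A) = γ.τ.embed B ↔
      ∃ s : S, m.cl s = t ∧ projStar s = A ∧ projPlus s = B := by
  constructor
  · rw [γ.τ.globalAction_embed_eq_iff, γ.act_j_inv, γ.act_j, rightAct_top]
    rintro ⟨hA, rfl⟩
    refine ⟨m.sec t * A.1, ?_, Subtype.ext ?_, rfl⟩
    · rw [m.cl_mul_proj A.2, m.cl_sec]
    · have h := congrArg Subtype.val (inf_eq_right.2 hA : projStar (m.sec t) ⊓ A = A)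
      exact (IsProj.rstar_mul_right A.2 _).trans h
  · rintro ⟨s, rfl, rfl, rfl⟩
    exact γ.globalAction_embed_projStar s

/-- The map `s ↦ (s⁺, sσ)`. -/
def toSemidirect (s : S) : SemidirectProd (γ.τ.globalAction.comp γ.j) :=
  ⟨γ.τ.embed (projPlus s), m.cl s⟩

theorem toSemidirect_isRestrictionEmbedding : IsRestrictionEmbedding γ.toSemidirect where
  injective a b h := m.eq_of_cl_eq (congrArg SemidirectProd.snd h)
    (congrArg Subtype.val (γ.τ.embed_injective (congrArg SemidirectProd.fst h)))
  map_mul a b := by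
    refine SemidirectProd.ext ?_ (map_mul m.cl a b)
    change γ.τ.embed (projPlus (a * b)) = γ.τ.embed (projPlus a) ⊓
      γ.τ.globalAction (γ.j (m.cl a)) (γ.τ.embed (projPlus b))
    rw [γ.τ.embed_inf_globalAction, γ.act_j]
    refine congrArg γ.τ.embed (Subtype.ext ?_)
    change rplus (a * b) = rplus a * rplus (m.sec (m.cl a) * rplus b)
    rw [← rplus_rplus_mul, ← mul_assoc, ← m.eq_rplus_mul_sec, rplus_mul_rplus]
  map_rplus a := SemidirectProd.ext
    (congrArg γ.τ.embed (Subtype.ext (isProj_rplus a).rplus_eq)) (m.cl_proj (isProj_rplus a))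
  map_rstar a := by
    refine SemidirectProd.ext ?_ (m.cl_proj (isProj_rstar a))
    change γ.τ.embed (projPlus (rstar a))
      = (γ.τ.globalAction (γ.j (m.cl a))).symm (γ.τ.embed (projPlus a))
    rw [← γ.globalAction_embed_projStar a, OrderIso.symm_apply_apply]
    exact congrArg γ.τ.embed (Subtype.ext (rplus_rstar a))

/-! ### Congruences -/

/-- The congruence on the globalization induced by a congruence `ρ` of `S`: pointwise `ρ`. -/
def traceCon (ρ : RestrictionCon S) : SemilatticeCon γ.τ.Globalization where
  r x y := ∀ g, ρ.r (x.val g).1 (y.val g).1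
  iseqv := ⟨fun _ _ => ρ.refl' _, fun h g => ρ.symm' (h g), fun h h' g => ρ.trans' (h g) (h' g)⟩
  inf' h h' g := ρ.mul' (h g) (h' g)

theorem traceCon_invariant (ρ : RestrictionCon S) :
    (γ.traceCon ρ).Invariant γ.τ.globalAction := fun g _ _ h k => h (k * g)

theorem traceCon_embed (ρ : RestrictionCon S) (A B : Proj S) :
    (γ.traceCon ρ).r (γ.τ.embed A) (γ.τ.embed B) ↔ ρ.r A.1 B.1 := by
  constructor
  · intro h
    have h1 := h 1
    rwa [γ.τ.embed_val, γ.τ.embed_val, γ.τ.act_one, γ.τ.act_one] at h1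
  · exact fun h g => γ.act_rel ρ g A B h

/-- For `ρ ⊆ σ`, the embedding of `S` induces one of `S/ρ`, since `ρ` is then determined by `σ` and
its restriction to `P(S)`. -/
theorem exists_quotient_embedding (ρ : RestrictionCon S) (hρ : ∀ a b : S, ρ.r a b → sigma S a b) :
    ∃ θ : ρ.Quotient → SemidirectProd
        (((γ.traceCon ρ).quotientAction γ.τ.globalAction (γ.traceCon_invariant ρ)).comp γ.j),
      IsRestrictionEmbedding θ := by
  set ε := γ.traceCon ρ
  have hε := γ.traceCon_invariant ρ
  let π := ε.mapSemidirect γ.τ.globalAction hε γ.j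
  have hψ := γ.toSemidirect_isRestrictionEmbedding
  have hwd : ∀ a b : S, ρ.r a b → π (γ.toSemidirect a) = π (γ.toSemidirect b) := fun a b h =>
    SemidirectProd.ext (Quotient.sound ((γ.traceCon_embed ρ _ _).2 (ρ.rplus' h)))
      ((m.cl_eq_iff a b).2 (hρ a b h))
  refine ⟨Quotient.lift (fun s => π (γ.toSemidirect s)) hwd, ?_, ?_, ?_, ?_⟩
  · rintro ⟨a⟩ ⟨b⟩ h
    have h1 : ε.cls (γ.τ.embed (projPlus a)) = ε.cls (γ.τ.embed (projPlus b)) :=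
      congrArg SemidirectProd.fst h
    have h2 : m.cl a = m.cl b := congrArg SemidirectProd.snd h
    exact Quotient.sound (m.con_of_cl_eq ρ h2 ((γ.traceCon_embed ρ _ _).1 (Quotient.exact h1)))
  · rintro ⟨a⟩ ⟨b⟩
    exact congrArg π (hψ.map_mul a b)
  · rintro ⟨a⟩
    exact congrArg π (hψ.map_rplus a)
  · rintro ⟨a⟩
    exact (congrArg π (hψ.map_rstar a)).trans (ε.mapSemidirect_rstar _ hε _ _)

/-- The elementary steps of the congruence on the semidirect product extending `ρ`: a change of the
first component modulo `traceCon ρ`, or the replacement of a factor `sσ` of the second component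
by `s'σ`, where `s ρ s'` and the first components are `v · s⁺` and `v · s'⁺` modulo
`traceCon ρ`. -/
inductive ExtStep (ρ : RestrictionCon S) (p q : SemidirectProd (γ.τ.globalAction.comp γ.j)) : Prop
  | trace (h : (γ.traceCon ρ).r p.fst q.fst) (h' : p.snd = q.snd)
  | subst (v w : M) (s s' : S) (h : ρ.r s s')
      (hp : (γ.traceCon ρ).r p.fst (γ.τ.globalAction (γ.j v) (γ.τ.embed (projPlus s))))
      (hq : (γ.traceCon ρ).r q.fst (γ.τ.globalAction (γ.j v) (γ.τ.embed (projPlus s'))))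
      (hp' : p.snd = v * m.cl s * w) (hq' : q.snd = v * m.cl s' * w)

variable {γ} {ρ : RestrictionCon S}

theorem ExtStep.symm {p q : SemidirectProd (γ.τ.globalAction.comp γ.j)} (h : γ.ExtStep ρ p q) :
    γ.ExtStep ρ q p := by
  cases h with
  | trace h h' => exact .trace ((γ.traceCon ρ).symm' h) h'.symm
  | subst v w s s' h hp hq hp' hq' => exact .subst v w s' s (ρ.symm' h) hq hp hq' hp'

/-- In the second case this holds because `s⁺ ρ s'⁺`. -/
theorem ExtStep.traceCon_fst {p q : SemidirectProd (γ.τ.globalAction.comp γ.j)}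
    (h : γ.ExtStep ρ p q) : (γ.traceCon ρ).r p.fst q.fst := by
  cases h with
  | trace h h' => exact h
  | subst v w s s' h hp hq hp' hq' =>
    exact (γ.traceCon ρ).trans' ((γ.traceCon ρ).trans' hp (γ.traceCon_invariant ρ _ _ _
      ((γ.traceCon_embed ρ (projPlus s) (projPlus s')).2 (ρ.rplus' h)))) ((γ.traceCon ρ).symm' hq)

variable (γ) in
/-- Here `x.val 1` is the meet of `x` with the identity of `P(S)`. -/
theorem embed_projPlus_mul (s : S) (x : γ.τ.Globalization) :
    γ.τ.embed (projPlus ((x.val 1).1 * s)) = γ.τ.embed (projPlus s) ⊓ x := by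
  rw [γ.τ.embed_inf_eq, inf_comm]
  exact congrArg γ.τ.embed (Subtype.ext (IsProj.rplus_mul (x.val 1).2 s))

variable (γ) in
theorem embed_projPlus_mul' (s : S) (x : γ.τ.Globalization) :
    γ.τ.embed (projPlus (s * (x.val 1).1))
      = γ.τ.embed (projPlus s) ⊓ γ.τ.globalAction (γ.j (m.cl s)) x := by
  have h : projStar (s * (x.val 1).1) = projStar s ⊓ x.val 1 :=
    Subtype.ext (IsProj.rstar_mul_right (x.val 1).2 s)
  rw [← γ.globalAction_embed_projStar, ← γ.globalAction_embed_projStar s, ← map_inf,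
    γ.τ.embed_inf_eq, h, m.cl_mul_proj (x.val 1).2]

/-- A first factor with first component `c` is absorbed by multiplying `s` and `s'` on the left by
the same projection, the part of the translate of `c` that lies in `P(S)`. -/
theorem ExtStep.mul_left {p q : SemidirectProd (γ.τ.globalAction.comp γ.j)}
    (h : γ.ExtStep ρ p q) (r : SemidirectProd (γ.τ.globalAction.comp γ.j)) :
    γ.ExtStep ρ (r * p) (r * q) := by
  obtain ⟨c, k⟩ := r
  cases h with
  | trace h h' =>
    exact .trace ((γ.traceCon ρ).inf' ((γ.traceCon ρ).refl' c) (γ.traceCon_invariant ρ _ _ _ h))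
      (congrArg (k * ·) h')
  | subst v w s s' h hp hq hp' hq' =>
    set x := γ.τ.globalAction (γ.j (k * v))⁻¹ c with hx
    have key : ∀ (a : γ.τ.Globalization) (s : S),
        (γ.traceCon ρ).r a (γ.τ.globalAction (γ.j v) (γ.τ.embed (projPlus s))) →
        (γ.traceCon ρ).r (c ⊓ γ.τ.globalAction (γ.j k) a)
          (γ.τ.globalAction (γ.j (k * v)) (γ.τ.embed (projPlus ((x.val 1).1 * s)))) := by
      intro a s ha
      have e : γ.τ.globalAction (γ.j (k * v)) (γ.τ.embed (projPlus ((x.val 1).1 * s)))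
          = c ⊓ γ.τ.globalAction (γ.j k)
            (γ.τ.globalAction (γ.j v) (γ.τ.embed (projPlus s))) := by
        rw [γ.embed_projPlus_mul, map_inf, hx, ← orderIso_symm_eq_map_inv,
          OrderIso.apply_symm_apply, inf_comm, map_mul, map_mul, RelIso.mul_apply]
      rw [e]
      exact (γ.traceCon ρ).inf' ((γ.traceCon ρ).refl' c) (γ.traceCon_invariant ρ _ _ _ ha)
    have key' : ∀ s, k * (v * m.cl s * w) = k * v * m.cl ((x.val 1).1 * s) * w := fun s => by
      rw [m.cl_proj_mul (x.val 1).2]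
      simp only [mul_assoc]
    exact .subst (k * v) w ((x.val 1).1 * s) ((x.val 1).1 * s') (ρ.mul' (ρ.refl' _) h)
      (key _ s hp) (key _ s' hq) ((congrArg (k * ·) hp').trans (key' s))
      ((congrArg (k * ·) hq').trans (key' s'))

/-- A last factor with first component `c` is absorbed by multiplying `s` and `s'` on the right by
the same projection, the part of `w · c` that lies in `P(S)`. -/
theorem ExtStep.mul_right {p q : SemidirectProd (γ.τ.globalAction.comp γ.j)}
    (h : γ.ExtStep ρ p q) (r : SemidirectProd (γ.τ.globalAction.comp γ.j)) :
    γ.ExtStep ρ (p * r) (q * r) := by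
  obtain ⟨c, k⟩ := r
  obtain ⟨a, t⟩ := p
  obtain ⟨b, u⟩ := q
  cases h with
  | trace h h' =>
    change (γ.traceCon ρ).r a b at h
    change t = u at h'
    subst h'
    exact .trace ((γ.traceCon ρ).inf' h ((γ.traceCon ρ).refl' _)) rfl
  | subst v w s s' h hp hq hp' hq' =>
    set x := γ.τ.globalAction (γ.j w) c with hx
    have key : ∀ (a : γ.τ.Globalization) (s : S),
        (γ.traceCon ρ).r a (γ.τ.globalAction (γ.j v) (γ.τ.embed (projPlus s))) →
        (γ.traceCon ρ).r (a ⊓ γ.τ.globalAction (γ.j (v * m.cl s * w)) c)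
          (γ.τ.globalAction (γ.j v) (γ.τ.embed (projPlus (s * (x.val 1).1)))) := by
      intro a s ha
      have e : γ.τ.globalAction (γ.j v) (γ.τ.embed (projPlus (s * (x.val 1).1)))
          = γ.τ.globalAction (γ.j v) (γ.τ.embed (projPlus s))
            ⊓ γ.τ.globalAction (γ.j (v * m.cl s * w)) c := by
        rw [γ.embed_projPlus_mul', map_inf, hx]
        simp only [map_mul, RelIso.mul_apply]
      rw [e]
      exact (γ.traceCon ρ).inf' ha ((γ.traceCon ρ).refl' _)
    have key' : ∀ s, v * m.cl s * w * k = v * m.cl (s * (x.val 1).1) * (w * k) := fun s => by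
      rw [m.cl_mul_proj (x.val 1).2]
      simp only [mul_assoc]
    change t = _ at hp'
    change u = _ at hq'
    subst hp' hq'
    exact .subst v (w * k) (s * (x.val 1).1) (s' * (x.val 1).1) (ρ.mul' h (ρ.refl' _))
      (key a s hp) (key b s' hq) (key' s) (key' s')

theorem ExtStep.map_rplus {p q : SemidirectProd (γ.τ.globalAction.comp γ.j)}
    (h : γ.ExtStep ρ p q) : γ.ExtStep ρ (rplus p) (rplus q) := .trace h.traceCon_fst rfl

theorem ExtStep.map_rstar {p q : SemidirectProd (γ.τ.globalAction.comp γ.j)}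
    (h : γ.ExtStep ρ p q) : γ.ExtStep ρ (rstar p) (rstar q) := by
  obtain ⟨a, t⟩ := p
  obtain ⟨b, u⟩ := q
  refine .trace ?_ rfl
  change (γ.traceCon ρ).r ((γ.τ.globalAction (γ.j t)).symm a)
    ((γ.τ.globalAction (γ.j u)).symm b)
  rw [orderIso_symm_eq_map_inv, orderIso_symm_eq_map_inv]
  cases h with
  | trace h h' =>
    change t = u at h'
    subst h'
    exact γ.traceCon_invariant ρ _ _ _ h
  | subst v w s s' h hp hq hp' hq' =>
    change t = _ at hp'
    change u = _ at hq'
    subst hp' hq'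
    have key : ∀ (a : γ.τ.Globalization) (s : S),
        (γ.traceCon ρ).r a (γ.τ.globalAction (γ.j v) (γ.τ.embed (projPlus s))) →
        (γ.traceCon ρ).r (γ.τ.globalAction (γ.j (v * m.cl s * w))⁻¹ a)
          (γ.τ.globalAction (γ.j w)⁻¹ (γ.τ.embed (projStar s))) := by
      intro a s ha
      have e : γ.τ.globalAction (γ.j w)⁻¹ (γ.τ.embed (projStar s))
          = γ.τ.globalAction (γ.j (v * m.cl s * w))⁻¹
            (γ.τ.globalAction (γ.j v) (γ.τ.embed (projPlus s))) := by
        have e' : (γ.j w)⁻¹ = (γ.j (v * m.cl s * w))⁻¹ * γ.j v * γ.j (m.cl s) := by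
          rw [map_mul, map_mul]
          group
        rw [← γ.globalAction_embed_projStar, e']
        simp only [map_mul, RelIso.mul_apply]
      rw [e]
      exact γ.traceCon_invariant ρ _ _ _ ha
    exact (γ.traceCon ρ).trans' ((γ.traceCon ρ).trans' (key a s hp) (γ.traceCon_invariant ρ _ _ _
      ((γ.traceCon_embed ρ (projStar s) (projStar s')).2 (ρ.rstar' h))))
      ((γ.traceCon ρ).symm' (key b s' hq))

/-- Elementary steps do not leave the image of `S` (up to `traceCon ρ`), and on it they are steps
of `ρ`. For a replacement, the element `s₀` with class `v (sσ) w` factors through the greatest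
elements of the classes of `v` and `w`, with `s` in the middle modulo `ρ`. -/
theorem ExtStep.exists_con {p q : SemidirectProd (γ.τ.globalAction.comp γ.j)}
    (h : γ.ExtStep ρ p q) (s₀ : S) (hs : m.cl s₀ = p.snd)
    (hs' : (γ.traceCon ρ).r (γ.τ.embed (projPlus s₀)) p.fst) :
    ∃ s₁, m.cl s₁ = q.snd ∧ (γ.traceCon ρ).r (γ.τ.embed (projPlus s₁)) q.fst ∧ ρ.r s₀ s₁ := by
  have hfst := h.traceCon_fst
  cases h with
  | trace h h' => exact ⟨s₀, hs.trans h', (γ.traceCon ρ).trans' hs' h, ρ.refl' _⟩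
  | subst v w s s' h hp hq hp' hq' =>
    -- pulling `s₀⁺` back along `v` gives `s⁺` modulo `ρ`
    have h1 : ρ.r (rstar (rplus s₀ * m.sec v)) (rplus s) := by
      have h2 := γ.traceCon_invariant ρ (γ.j v)⁻¹ _ _ ((γ.traceCon ρ).trans' hs' hp) 1
      rw [← orderIso_symm_eq_map_inv _ _ (γ.τ.globalAction (γ.j v) _), OrderIso.symm_apply_apply,
        γ.τ.globalAction_val, γ.τ.embed_val, γ.τ.embed_val, one_mul, γ.act_j_inv,
        γ.τ.act_one] at h2
      exact h2
    have h2 : ρ.r s₀ (rplus s₀ * m.sec v * s * m.sec w) := by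
      have e1 : s₀ = rplus s₀ * m.sec v * rstar (rplus s₀ * m.sec v) * m.sec (m.cl s)
          * m.sec w := by
        rw [mul_rstar_self]
        conv_lhs => rw [m.eq_rplus_mul_sec s₀, hs, hp', map_mul, map_mul]
        simp only [mul_assoc]
      have e2 : rplus s₀ * m.sec v * s * m.sec w
          = rplus s₀ * m.sec v * rplus s * m.sec (m.cl s) * m.sec w := by
        rw [mul_assoc (rplus s₀ * m.sec v) (rplus s), ← m.eq_rplus_mul_sec]
      have e3 := ρ.mul' (ρ.mul' (ρ.mul' (ρ.refl' (rplus s₀ * m.sec v)) h1)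
        (ρ.refl' (m.sec (m.cl s)))) (ρ.refl' (m.sec w))
      rwa [← e1, ← e2] at e3
    have h3 : ρ.r s₀ (rplus s₀ * m.sec v * s' * m.sec w) :=
      ρ.trans' h2 (ρ.mul' (ρ.mul' (ρ.refl' _) h) (ρ.refl' _))
    refine ⟨_, ?_, ?_, h3⟩
    · rw [hq', map_mul, map_mul, m.cl_proj_mul (isProj_rplus s₀), m.cl_sec, m.cl_sec]
    · exact (γ.traceCon ρ).trans' ((γ.traceCon_embed ρ _ _).2 (ρ.symm' (ρ.rplus' h3)))
        ((γ.traceCon ρ).trans' hs' hfst)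

variable (γ ρ) in
/-- The congruence on the semidirect product generated by the elementary steps. -/
def extCon : RestrictionCon (SemidirectProd (γ.τ.globalAction.comp γ.j)) where
  r := Relation.ReflTransGen (γ.ExtStep ρ)
  iseqv := ⟨fun _ => .refl, fun h => by
    induction h with
    | refl => exact .refl
    | tail _ h ih => exact ih.head h.symm, fun h h' => h.trans h'⟩
  mul' {a b c d} h h' :=
    (Relation.ReflTransGen.lift (· * c) (fun _ _ h => h.mul_right c) _ _ h).trans
      (Relation.ReflTransGen.lift (b * ·) (fun _ _ h => h.mul_left b) _ _ h')
  rplus' h := Relation.ReflTransGen.lift rplus (fun _ _ h => h.map_rplus) _ _ h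
  rstar' h := Relation.ReflTransGen.lift rstar (fun _ _ h => h.map_rstar) _ _ h

variable (γ ρ) in
/-- Every congruence of `S` extends to the semidirect product. -/
theorem extendsAlong : ρ.ExtendsAlong γ.toSemidirect := by
  refine ⟨γ.extCon ρ, fun a b => ⟨fun h => ?_, fun h => ?_⟩⟩
  · have key : ∀ q, Relation.ReflTransGen (γ.ExtStep ρ) (γ.toSemidirect a) q →
        ∃ s₁, m.cl s₁ = q.snd ∧ (γ.traceCon ρ).r (γ.τ.embed (projPlus s₁)) q.fst ∧
          ρ.r a s₁ := by
      intro q hq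
      induction hq with
      | refl => exact ⟨a, rfl, (γ.traceCon ρ).refl' _, ρ.refl' _⟩
      | tail _ h ih =>
        obtain ⟨s₁, h1, h2, h3⟩ := ih
        obtain ⟨s₂, h4, h5, h6⟩ := h.exists_con s₁ h1 h2
        exact ⟨s₂, h4, h5, ρ.trans' h3 h6⟩
    obtain ⟨s₁, h1, h2, h3⟩ := key _ h
    exact ρ.trans' h3 (m.con_of_cl_eq ρ h1 ((γ.traceCon_embed ρ _ _).1 h2))
  · refine .single (.subst 1 1 a b h ?_ ?_ ?_ ?_)
    · rw [map_one, map_one]; exact (γ.traceCon ρ).refl' _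
    · rw [map_one, map_one]; exact (γ.traceCon ρ).refl' _
    · rw [one_mul, mul_one]; rfl
    · rw [one_mul, mul_one]; rfl

end GroupModel

/-! ### The free case -/

section Free

variable {S Ω : Type*} [RestrictionMonoid S] (m : MaxSection S (FreeMonoid Ω))

/-- The partial maps on `P(S)` given by the letters of `Ω` and their inverses. -/
def letterAct (l : Ω × Bool) : Proj S → Proj S :=
  if l.2 then leftAct (m.sec (FreeMonoid.of l.1)) else rightAct (m.sec (FreeMonoid.of l.1))

theorem letterAct_inf (l : Ω × Bool) (A B : Proj S) :
    letterAct m l (A ⊓ B) = letterAct m l A ⊓ letterAct m l B := by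
  obtain ⟨x, _ | _⟩ := l
  · exact rightAct_inf _ A B
  · exact leftAct_inf _ A B

theorem letterAct_letterAct (l : Ω × Bool) (A : Proj S) :
    letterAct m l (letterAct m (l.1, !l.2) A) = A ⊓ letterAct m l ⊤ := by
  obtain ⟨x, _ | _⟩ := l
  · exact (rightAct_leftAct _ A).trans (by rw [← rightAct_top]; rfl)
  · exact (leftAct_rightAct _ A).trans (by rw [← leftAct_top]; rfl)

/-- As `Ω*` is free, its partial action on `P(S)` extends to the free group. -/
noncomputable def freeModel : GroupModel m (FreeGroup Ω) where
  j := freeInclusion Ω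
  τ := .ofLetters (letterAct m) (letterAct_inf m) (letterAct_letterAct m)
  act_j t A := by
    rw [PartialAction.ofLetters_freeInclusion]
    induction t using FreeMonoid.inductionOn' with
    | one =>
      rw [map_one m.sec, leftAct_one]
      rfl
    | of_mul x t ih =>
      rw [map_mul m.sec, leftAct_mul, ← ih]
      rfl
  act_rel ρ g A B h := PartialAction.ofLetters_rel (r := fun A B : Proj S => ρ.r A.1 B.1) _ _
    (fun l A B h => by
      obtain ⟨x, _ | _⟩ := l
      · exact ρ.rightAct _ h
      · exact ρ.leftAct _ h) g h

theorem freeModel_isNiceSemidirectProd :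
    IsNiceSemidirectProd (freeInclusion Ω) (freeModel m).τ.globalAction
      ((freeModel m).τ.embed ⊤) := by
  refine ⟨freeInclusion_injective, fun g => ?_, fun x => ?_⟩
  · obtain ⟨ε, w, hne, rfl, hw⟩ := exists_niceList (letterAct_inf m) (letterAct_letterAct m) g
    exact ⟨w, hw.isNiceFactorisation hne⟩
  · obtain ⟨g, b, rfl⟩ := (freeModel m).τ.exists_eq_globalAction_embed x
    exact ⟨g, _, (freeModel m).τ.embed_mono le_top, rfl⟩

end Free

theorem mainTheorem5 {S : Type u} [RestrictionMonoid S] (hS : IsPerfectRestrictionMonoid S)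
    {Ω : Type v} (φ : (sigma S).Quotient ≃* FreeMonoid Ω) :
    ∃ (X : Type (max u v)) (_ : SemilatticeInf X) (β : FreeGroup Ω →* (X ≃o X)) (ι : Proj S → X),
      -- `P(S)` is a principal ideal of the semilattice `X`
      (Function.Injective ι ∧ (∀ e f, ι (e ⊓ f) = ι e ⊓ ι f) ∧
        Set.range ι = Set.Iic (ι (projOne S))) ∧
      -- the action of `S/σ` extends the induced left partial action on `P(S)`
      (∀ (t : (sigma S).Quotient) (A B : Proj S),
        β (freeInclusion Ω (φ t)) (ι A) = ι B ↔ InducedPartialAction t A B) ∧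
      -- the action is nice over `FG(Ω)` with respect to the identity of `P(S)`, `X = FG(Ω)·P(S)`
      IsNiceSemidirectProd (freeInclusion Ω) β (ι (projOne S)) ∧
      -- `X ⋊ Ω*` is a `(2,1,1)`-subsemigroup of the inverse semigroup `X ⋊ FG(Ω)`
      IsInverseSemigroup (SemidirectProd β) ∧
      IsRestrictionEmbedding (SemidirectProd.inclusion (freeInclusion Ω) β) ∧
      -- the embedding of `S`, and its properties (i) and (ii)
      ∃ ψ : S → SemidirectProd (β.comp (freeInclusion Ω)),
        IsRestrictionEmbedding ψ ∧
        (∀ s : S, ψ s = ⟨ι (projPlus s), φ (s : (sigma S).Quotient)⟩) ∧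
        (∀ ρ : RestrictionCon S, ρ.ExtendsAlong ψ) ∧
        (∀ ρ : RestrictionCon S, (∀ a b : S, ρ.r a b → sigma S a b) →
          ∃ (ε : SemilatticeCon X) (hε : ε.Invariant β),
            IsNiceSemidirectProd (freeInclusion Ω) (ε.quotientAction β hε)
              (ε.cls (ι (projOne S))) ∧
            ∃ θ : ρ.Quotient →
                SemidirectProd ((ε.quotientAction β hε).comp (freeInclusion Ω)),
              IsRestrictionEmbedding θ) := by
  obtain ⟨m, hm⟩ := exists_maxSection hS φ
  let γ := freeModel m
  have hnice := freeModel_isNiceSemidirectProd m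
  refine ⟨γ.τ.Globalization, inferInstance, γ.τ.globalAction, γ.τ.embed,
    ⟨γ.τ.embed_injective, γ.τ.embed_inf, γ.τ.range_embed⟩, fun t A B => ?_, hnice,
    semidirectProd_isInverseSemigroup _,
    SemidirectProd.inclusion_isRestrictionEmbedding freeInclusion_injective _,
    γ.toSemidirect, γ.toSemidirect_isRestrictionEmbedding,
    fun s => SemidirectProd.ext rfl (hm s), γ.extendsAlong, fun ρ hρ => ?_⟩
  · refine (γ.globalAction_j_embed_eq_iff (φ t) A B).trans (exists_congr fun s => ?_)
    rw [hm, φ.injective.eq_iff]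
  · exact ⟨γ.traceCon ρ, γ.traceCon_invariant ρ,
      SemilatticeCon.isNiceSemidirectProd_quotient _ _ _ hnice, γ.exists_quotient_embedding ρ hρ⟩
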